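/- Let $n$ be a number of tasks, let $\mathcal F$ be a measurable space of models and let $\mathcal M(\mathcal F)$ be the set of probability measures on $\mathcal F$, with the $\sigma$-algebra generated by the evaluations $P\mapsto P(A)$. For each task $i=1,\dots,n$ let $D_i$ be a probability distribution on a measurable space $\mathcal Z_i$, let $\ell_i:\mathcal F\times\mathcal Z_i\to[0,1]$ be a jointly measurable loss, and let $S_i=(z_{i1},\dots,z_{im_i})$ consist of $m_i\ge 1$ i.i.d. samples from $D_i$; the datasets $S_1,\dots,S_n$ are independent and the sizes $m_i$ may differ. For $Q\in\mathcal M(\mathcal F)$ put $\ell_i(Q,z)=\mathbb E_{f\sim Q}\,\ell_i(f,z)$, $$R_i(Q)=\mathbb E_{z\sim D_i}\,\ell_i(Q,z),\qquad \widehat R_i(Q)=\frac1{m_i}\sum_{j=1}^{m_i}\ell_i(Q,z_{ij}).$$ Let $\mathrm{kl}(q|p)=q\log\frac qp+(1-q)\log\frac{1-q}{1-p}\in[0,\infty]$ for $q,p\in[0,1]$, with the conventions $0\log\frac 0p=0$ for all $p\in[0,1]$ and $q\log\frac q0=\infty$ for $q>0$. For a hyper-prior $\mathcal P\in\mathcal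 M(\mathcal M(\mathcal F))$, let $\mathfrak P$ be the law on $\mathcal M(\mathcal F)\times\mathcal F^n$ of $(P,f_1,\dots,f_n)$, where $P\sim\mathcal P$ and then $f_1,\dots,f_n$ are drawn independently from $P$. For a hyper-posterior $\mathcal Q\in\mathcal M(\mathcal M(\mathcal F))$ and task posteriors $Q_1,\dots,Q_n\in\mathcal M(\mathcal F)$, let $\mathfrak Q=\mathcal Q\times Q_1\times\dots\times Q_n$. Let $\mathrm{KL}(\mathfrak Q\|\mathfrak P)\in[0,\infty]$ denote the Kullback–Leibler divergence. **Theorem.** Fix a hyper-prior $\mathcal P$. 1. For every $\delta>0$, with probability at least $1-\delta$ over $S_1,\dots,S_n$, simultaneously for all hyper-posteriors $\mathcal Q$ and all posteriors $Q_1,\dots,Q_n$ (which may therefore depend on the data), $$\sum_{i=1}^n m_i\,\mathrm{kl}\bigl(\widehat R_i(Q_i)\,\big|\,R_i(Q_i)\bigr)\le \mathrm{KL}(\mathfrak Q\|\mathfrak P)+\log\frac1\delta+\sum_{i=1}^n\log(2\sqrt{m_i}).$$ 2. For every $\delta>0$ and all $\lambda_1,\dots,\lambda_n>0$, with probability at least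 $1-\delta$ over $S_1,\dots,S_n$, simultaneously for all hyper-posteriors $\mathcal Q$ and all posteriors $Q_1,\dots,Q_n$, $$-\sum_{i=1}^n m_i\log\Bigl(1-R_i(Q_i)+R_i(Q_i)\,e^{-\lambda_i/(n m_i)}\Bigr)\le \frac1n\sum_{i=1}^n\lambda_i\,\widehat R_i(Q_i)+\mathrm{KL}(\mathfrak Q\|\mathfrak P)+\log\frac1\delta .$$ Here "with probability at least $1-\delta$" means that the inequality holds, for all $\mathcal Q,Q_1,\dots,Q_n$, on a measurable event of probability at least $1-\delta$. -/

import Mathlib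

open MeasureTheory ProbabilityTheory

namespace PACBayesMTL

/-- `kl(q | p) = q log (q / p) + (1 - q) log ((1 - q) / (1 - p))`, for `q, p ∈ [0, 1]`, with values
in `[0, ∞]` and the usual conventions: `0 log (0 / p) = 0` for every `p` (including `p = 0`), and
`q log (q / 0) = ∞` for `q > 0`. -/
noncomputable def binKL (q p : ℝ) : EReal :=
  open Classical in
  if (p = 0 ∧ q ≠ 0) ∨ (p = 1 ∧ q ≠ 1) then ⊤
  else ((q * Real.log (q / p) + (1 - q) * Real.log ((1 - q) / (1 - p)) : ℝ) : EReal)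

section Risks

variable {F Z : Type*} [MeasurableSpace F] [MeasurableSpace Z]

/-- The loss of a stochastic model: `ℓ(Q, z) = 𝔼_{f ∼ Q} ℓ(f, z)`. -/
noncomputable def gibbsLoss (ℓ : F → Z → ℝ) (Q : ProbabilityMeasure F) (z : Z) : ℝ :=
  ∫ f, ℓ f z ∂(Q : Measure F)

/-- The risk `R(Q) = 𝔼_{z ∼ D} ℓ(Q, z)`. -/
noncomputable def risk (D : ProbabilityMeasure Z) (ℓ : F → Z → ℝ) (Q : ProbabilityMeasure F) : ℝ :=
  ∫ z, gibbsLoss ℓ Q z ∂(D : Measure Z)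

/-- The training risk `R̂(Q) = (1 / m) ∑ j, ℓ(Q, z_j)` on the dataset `z_1, …, z_m`. -/
noncomputable def empRisk {m : ℕ} (ℓ : F → Z → ℝ) (s : Fin m → Z) (Q : ProbabilityMeasure F) : ℝ :=
  (1 / (m : ℝ)) * ∑ j, gibbsLoss ℓ Q (s j)

end Risks

/-- The law of the collection of all training datasets: task `i` has `m i` samples that are i.i.d.
from `D i`, and the datasets of different tasks are independent. -/
noncomputable def dataLaw {n : ℕ} {Z : Fin n → Type*} [∀ i, MeasurableSpace (Z i)] (m : Fin n → ℕ)
    (D : ∀ i, ProbabilityMeasure (Z i)) : Measure (∀ i, Fin (m i) → Z i) :=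
  Measure.pi fun i => Measure.pi fun _ : Fin (m i) => (D i : Measure (Z i))

section Joint

variable {F : Type*} [MeasurableSpace F]

theorem measurable_iidLaw (n : ℕ) :
    Measurable fun P : ProbabilityMeasure F => Measure.pi fun _ : Fin n => (P : Measure F) := by
  refine Measurable.measure_of_isPiSystem_of_isProbabilityMeasure
    (generateFrom_pi (α := fun _ : Fin n => F)).symm isPiSystem_pi ?_
  rintro _ ⟨t, ht, rfl⟩
  simp only [Measure.pi_pi]
  refine Finset.measurable_prod _ fun i _ => ?_
  exact (Measure.measurable_coe (ht i (Set.mem_univ i))).comp measurable_subtype_coe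

/-- The Markov kernel that draws, given a prior `P`, `n` models independently from `P`. -/
noncomputable def iidKernel (F : Type*) [MeasurableSpace F] (n : ℕ) :
    Kernel (ProbabilityMeasure F) (Fin n → F) where
  toFun P := Measure.pi fun _ : Fin n => (P : Measure F)
  measurable' := measurable_iidLaw n

instance isMarkovKernel_iidKernel (n : ℕ) : IsMarkovKernel (iidKernel F n) :=
  ⟨fun P => by change IsProbabilityMeasure (Measure.pi _); infer_instance⟩

/-- The joint prior, the law of `(P, f_1, …, f_n)` where `P` is drawn from the hyper-prior and then
`f_1, …, f_n` are drawn independently from `P`. The space of priors `ProbabilityMeasure F`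
carries the σ-algebra generated by the evaluations `P ↦ P(A)`. -/
noncomputable def jointPrior (n : ℕ) (hyperPrior : ProbabilityMeasure (ProbabilityMeasure F)) :
    Measure (ProbabilityMeasure F × (Fin n → F)) :=
  (hyperPrior : Measure (ProbabilityMeasure F)).compProd (iidKernel F n)

/-- The joint posterior, the product `hyperPost × Q_1 × ⋯ × Q_n` of the hyper-posterior and the task
posteriors. -/
noncomputable def jointPosterior {n : ℕ} (hyperPost : ProbabilityMeasure (ProbabilityMeasure F))
    (Q : Fin n → ProbabilityMeasure F) : Measure (ProbabilityMeasure F × (Fin n → F)) :=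
  (hyperPost : Measure (ProbabilityMeasure F)).prod (Measure.pi fun i => (Q i : Measure F))

end Joint

end PACBayesMTL

open PACBayesMTL

/-! Both bounds follow one scheme. The joint prior is fixed before the data are drawn, so Tonelli,
independence of the tasks and Markov's inequality bound, on a single event, the prior average of a
product of nonnegative statistics `G i` whose data expectations are at most `C i`. On that event the
Donsker–Varadhan inequality carries the bound to every joint posterior at the cost of the KL
divergence (`exists_event_integral_le`). Only exponents affine in the losses and the risk are
integrated, so Gibbs averages come out exactly (`exists_event_affine_le`); convex targets are
reached through their supporting affine functions.

For the first bound, kl is the supremum of the affine functionals `klTangent t u`. Their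
exponentials, for all `t, u > 0` at once, lie below the single statistic `klMixture`, so `t, u` may
be chosen after the data. Its expectation is at most `∑ C(m,k) (k/m)^k ((m-k)/m)^(m-k)`. Cauchy's
convolution, derived from Abel's identity, rewrites this as `∑ m(m-1)⋯(m-j+1) / m^j`, which is at
most `2√m`.

For the second bound, the convex function `-log (1 - r + r exp (-c))` is replaced by its tangent at
the posterior risk, and convexity of `exp` bounds the exponential moment by `1`. -/

namespace PACBayesMTL

/-! ### Abel's binomial identity and Cauchy's convolution -/

section AbelIdentity

/-- The polynomial `x (x + k)^(k - 1)` of Abel's binomial identity, equal to `1` for `k = 0`. -/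
def abelPoly (x : ℝ) : ℕ → ℝ
  | 0 => 1
  | k + 1 => x * (x + (k + 1 : ℕ)) ^ k

theorem abelPoly_mul_pow (x : ℝ) {n k : ℕ} (hk : k ≤ n + 1) :
    abelPoly x k * (x + k) ^ (n + 1 - k) = x * (x + k) ^ n := by
  cases k with
  | zero => simp [abelPoly, pow_succ']
  | succ k =>
    have : n = k + (n + 1 - (k + 1)) := by omega
    conv_rhs => rw [this, pow_add]
    simp only [abelPoly]
    ring

/-- This is an `(n + 1)`-st forward difference of a polynomial of degree `n`. -/
theorem sum_choose_mul_neg_one_pow_mul_pow (x : ℝ) (n : ℕ) :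
    ∑ k ∈ Finset.range (n + 2), ((n + 1).choose k : ℝ) * (-1) ^ (n + 1 - k) * (x + k) ^ n = 0 := by
  have h := congrFun (fwdDiff_iter_pow_eq_zero_of_lt (R := ℝ) (Nat.lt_succ_self n)) x
  rw [fwdDiff_iter_eq_sum_shift] at h
  simp only [Pi.zero_apply, zsmul_eq_mul, nsmul_eq_mul, mul_one] at h
  rw [← h]
  refine Finset.sum_congr rfl fun k _ => ?_
  push_cast
  ring

/-- Abel's binomial identity. -/
theorem sum_choose_mul_abelPoly_mul_pow (x : ℝ) (n : ℕ) (y : ℝ) :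
    ∑ k ∈ Finset.range (n + 1), (n.choose k : ℝ) * abelPoly x k * (y + (n - k : ℕ)) ^ (n - k)
      = (x + y + n) ^ n := by
  induction n generalizing y with
  | zero => simp [abelPoly]
  | succ n ih =>
    let f : ℝ → ℝ := fun y => ∑ k ∈ Finset.range (n + 2), ((n + 1).choose k : ℝ) * abelPoly x k
      * (y + (n + 1 - k : ℕ)) ^ (n + 1 - k) - (x + y + (n + 1 : ℕ)) ^ (n + 1)
    -- Differentiating in `y` gives `n + 1` times the identity for `n` at `y + 1`; hence `f` is
    -- constant and one value of `y` suffices.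
    have hderiv : ∀ y, HasDerivAt f 0 y := by
      intro y
      have h1 : ∀ k ∈ Finset.range (n + 2), HasDerivAt (fun y : ℝ => ((n + 1).choose k : ℝ)
          * abelPoly x k * (y + (n + 1 - k : ℕ)) ^ (n + 1 - k))
          (((n + 1).choose k : ℝ) * abelPoly x k
            * ((n + 1 - k : ℕ) * (y + (n + 1 - k : ℕ)) ^ (n + 1 - k - 1) * 1)) y := fun k _ =>
        (((hasDerivAt_id y).add_const _).pow _).const_mul _
      have h2 : HasDerivAt (fun y : ℝ => (x + y + (n + 1 : ℕ)) ^ (n + 1))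
          ((n + 1 : ℕ) * (x + y + (n + 1 : ℕ)) ^ n * 1) y := by
        exact (((hasDerivAt_id y).const_add x).add_const ((n + 1 : ℕ) : ℝ)).pow (n + 1)
      have h3 := (HasDerivAt.fun_sum h1).sub h2
      convert! h3 using 1
      rw [Finset.sum_range_succ]
      have ihy := ih (y + 1)
      have hcast : x + y + (n + 1 : ℕ) = x + (y + 1) + n := by push_cast; ring
      rw [hcast, ← ihy, Finset.mul_sum, Finset.sum_mul]
      simp only [Nat.sub_self, Nat.cast_zero, zero_mul, mul_zero, add_zero]
      rw [eq_comm, sub_eq_zero]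
      refine Finset.sum_congr rfl fun k hk => ?_
      have hk' : k ≤ n := Nat.lt_succ_iff.mp (Finset.mem_range.mp hk)
      have hch : ((n + 1).choose k : ℝ) * (n + 1 - k : ℕ) = (n + 1 : ℕ) * (n.choose k : ℝ) := by
        have := Nat.choose_mul_succ_eq n k
        exact_mod_cast (by rw [← this, mul_comm] : (n + 1).choose k * (n + 1 - k) = (n + 1) * n.choose k)
      have e1 : n + 1 - k - 1 = n - k := by omega
      have e2 : ((n + 1 - k : ℕ) : ℝ) = 1 + (n - k : ℕ) := by
        rw [Nat.succ_sub hk']; push_cast; ring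
      rw [e1, show y + ((n + 1 - k : ℕ) : ℝ) = y + 1 + (n - k : ℕ) by rw [e2]; ring]
      linear_combination (abelPoly x k * (y + 1 + (n - k : ℕ)) ^ (n - k)) * hch
    have hconst : ∀ y z, f y = f z := fun y z =>
      is_const_of_deriv_eq_zero (fun y => (hderiv y).differentiableAt) (fun y => (hderiv y).deriv) y z
    -- Here the right-hand power vanishes and `y + (n + 1 - k)` becomes `-(x + k)`, which merges
    -- with the Abel factor into a vanishing finite difference.
    have hzero : f (-x - (n + 1 : ℕ)) = 0 := by
      have : ∑ k ∈ Finset.range (n + 2), ((n + 1).choose k : ℝ) * abelPoly x k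
          * (-x - (n + 1 : ℕ) + (n + 1 - k : ℕ)) ^ (n + 1 - k)
          = x * ∑ k ∈ Finset.range (n + 2),
            ((n + 1).choose k : ℝ) * (-1) ^ (n + 1 - k) * (x + k) ^ n := by
        rw [Finset.mul_sum]
        refine Finset.sum_congr rfl fun k hk => ?_
        have hk' : k ≤ n + 1 := Nat.lt_succ_iff.mp (Finset.mem_range.mp hk)
        rw [show -x - ((n + 1 : ℕ) : ℝ) + (n + 1 - k : ℕ) = -1 * (x + k) by
          rw [Nat.cast_sub hk']; ring, mul_pow]
        linear_combination (((n + 1).choose k : ℝ) * (-1) ^ (n + 1 - k)) * abelPoly_mul_pow x hk'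
      simp only [f]
      rw [this, sum_choose_mul_neg_one_pow_mul_pow, mul_zero, zero_sub, neg_eq_zero]
      exact pow_eq_zero_iff n.succ_ne_zero |>.mpr (by ring)
    have := (hconst y _).trans hzero
    exact sub_eq_zero.mp this

theorem pow_eq_abelPoly_add (x : ℝ) (k : ℕ) :
    (x + k) ^ k = abelPoly x k + k * (x + k) ^ (k - 1) := by
  cases k with
  | zero => simp [abelPoly]
  | succ k => simp only [abelPoly, Nat.add_sub_cancel]; ring

/-- Cauchy's convolution of the polynomials `(x + k)^k`. -/
theorem sum_choose_mul_pow_mul_pow (n : ℕ) (x y : ℝ) :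
    ∑ k ∈ Finset.range (n + 1), (n.choose k : ℝ) * (x + k) ^ k * (y + (n - k : ℕ)) ^ (n - k)
      = ∑ j ∈ Finset.range (n + 1), (n.descFactorial j : ℝ) * (x + y + n) ^ (n - j) := by
  induction n generalizing x with
  | zero => simp
  | succ n ih =>
    -- Abel's identity sums the `abelPoly` part of `(x + k)^k`; the remainder is the convolution for
    -- `n` at `x + 1`, and this shift keeps `x + y + n` unchanged.
    have h1 : ∑ k ∈ Finset.range (n + 2), ((n + 1).choose k : ℝ) * (x + k) ^ k
          * (y + (n + 1 - k : ℕ)) ^ (n + 1 - k)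
        = (x + y + (n + 1 : ℕ)) ^ (n + 1) + (n + 1) * ∑ k ∈ Finset.range (n + 1),
          (n.choose k : ℝ) * (x + 1 + k) ^ k * (y + (n - k : ℕ)) ^ (n - k) := by
      rw [← sum_choose_mul_abelPoly_mul_pow x (n + 1) y, Finset.sum_range_succ' (n := n + 1),
        Finset.sum_range_succ' (n := n + 1), Finset.mul_sum, add_right_comm, ← Finset.sum_add_distrib]
      congr 1
      refine Finset.sum_congr rfl fun k _ => ?_
      rw [pow_eq_abelPoly_add, Nat.add_sub_cancel, Nat.add_sub_add_right]
      have hch : ((n + 1).choose (k + 1) : ℝ) * (k + 1 : ℕ) = (n + 1) * n.choose k := by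
        exact_mod_cast (Nat.add_one_mul_choose_eq n k).symm
      have e : x + ((k + 1 : ℕ) : ℝ) = x + 1 + k := by push_cast; ring
      rw [e]
      linear_combination ((x + 1 + k) ^ k * (y + (n - k : ℕ)) ^ (n - k)) * hch
    rw [h1, ih (x + 1), Finset.sum_range_succ' (n := n + 1), Finset.mul_sum, add_comm]
    congr 1
    · refine Finset.sum_congr rfl fun j _ => ?_
      rw [Nat.succ_descFactorial_succ, Nat.add_sub_add_right]
      push_cast
      rw [show x + 1 + y + (n : ℝ) = x + y + (n + 1) by ring]
      ring
    · simp

end AbelIdentity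

/-! ### The binomial sum of maximal likelihoods is at most `2√n` -/

/-- A bathtub argument: the weights `T j` lie in `[0, 1]` and, by a telescoping recursion, have
first moment exactly `n`. Testing them against `K - j` limits their total mass. -/
theorem sum_descFactorial_div_pow_le {n : ℕ} (hn : 1 ≤ n) :
    ∑ j ∈ Finset.range (n + 1), (n.descFactorial j : ℝ) / n ^ j ≤ 2 * √n := by
  have hn0 : (0 : ℝ) < n := by exact_mod_cast hn
  set T : ℕ → ℝ := fun j => (n.descFactorial j : ℝ) / n ^ j with hT
  have hT0 : ∀ j, 0 ≤ T j := fun j => by positivity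
  have hT1 : ∀ j, T j ≤ 1 := fun j => by
    rw [hT]
    refine div_le_one_of_le₀ ?_ (by positivity)
    exact_mod_cast Nat.descFactorial_le_pow n j
  have hrec : ∀ j, j ≤ n → (j : ℝ) * T j = n * (T j - T (j + 1)) := fun j hj => by
    simp only [hT, Nat.descFactorial_succ]
    push_cast [Nat.cast_sub hj]
    field_simp
    ring
  have hsum : ∑ j ∈ Finset.range (n + 1), (j : ℝ) * T j = n := by
    rw [Finset.sum_congr rfl fun j hj => hrec j (Nat.lt_succ_iff.mp (Finset.mem_range.mp hj)),
      ← Finset.mul_sum, Finset.sum_range_sub']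
    simp [hT]
  set s := √(n : ℝ) with hs
  have hs2 : s * s = n := Real.mul_self_sqrt hn0.le
  have hs1 : 1 ≤ s := by rw [hs, Real.one_le_sqrt]; exact_mod_cast hn
  set K := ⌊2 * s⌋₊ with hK
  have hKle : (K : ℝ) ≤ 2 * s := Nat.floor_le (by positivity)
  have hKgt : 2 * s < K + 1 := Nat.lt_floor_add_one _
  have hK0 : (0 : ℝ) < K := by linarith
  have hgauss : ∀ N : ℕ, ∑ j ∈ Finset.range N, ((K : ℝ) - j) = N * K - N * (N - 1) / 2 := fun N => by
    induction N with
    | zero => simp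
    | succ N ih => rw [Finset.sum_range_succ, ih]; push_cast; ring
  have hpart : ∑ j ∈ Finset.range (n + 1), T j * (K - j) ≤ ∑ j ∈ Finset.range K, ((K : ℝ) - j) := by
    calc ∑ j ∈ Finset.range (n + 1), T j * (K - j)
        ≤ ∑ j ∈ Finset.range (n + 1), if j < K then ((K : ℝ) - j) else 0 := by
          refine Finset.sum_le_sum fun j _ => ?_
          split_ifs with h
          · have : (j : ℝ) ≤ K := by exact_mod_cast h.le
            nlinarith [hT1 j]
          · have : (K : ℝ) ≤ j := by exact_mod_cast not_lt.mp h
            nlinarith [hT0 j]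
      _ = ∑ j ∈ (Finset.range (n + 1)).filter (· < K), ((K : ℝ) - j) := by
          rw [Finset.sum_filter]
      _ ≤ _ := by
          refine Finset.sum_le_sum_of_subset_of_nonneg (fun j hj => ?_) fun j hj _ => ?_
          · exact Finset.mem_range.mpr (Finset.mem_filter.mp hj).2
          · have : (j : ℝ) ≤ K := by exact_mod_cast (Finset.mem_range.mp hj).le
            linarith
  rw [hgauss] at hpart
  have hexp : ∑ j ∈ Finset.range (n + 1), T j * (K - j)
      = K * ∑ j ∈ Finset.range (n + 1), T j - n := by
    rw [← hsum, Finset.mul_sum, ← Finset.sum_sub_distrib]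
    exact Finset.sum_congr rfl fun j _ => by ring
  rw [hexp] at hpart
  -- With `n = s²` this reduces to `(2s - K)(K + 1 - 2s) ≥ 0` and `s ≤ s²`, which explains the
  -- choice of `K` as the floor of `2s`.
  have hfin : (K : ℝ) * ∑ j ∈ Finset.range (n + 1), T j ≤ K * (2 * s) := by
    nlinarith [mul_nonneg (sub_nonneg.mpr hKle) (sub_nonneg.mpr hKgt.le)]
  exact le_of_mul_le_mul_left hfin hK0

/-- The maximal likelihood of a Bernoulli sample with `k` successes and `l` failures. -/
noncomputable def maxLik (k l : ℕ) : ℝ := (k / (k + l : ℕ)) ^ k * (l / (k + l : ℕ)) ^ l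

theorem sum_choose_mul_maxLik_le {n : ℕ} (hn : 1 ≤ n) :
    ∑ k ∈ Finset.range (n + 1), (n.choose k : ℝ) * maxLik k (n - k) ≤ 2 * √n := by
  have hn0 : (n : ℝ) ≠ 0 := by exact_mod_cast (by omega : n ≠ 0)
  refine le_trans (le_of_eq ?_) (sum_descFactorial_div_pow_le hn)
  have h := sum_choose_mul_pow_mul_pow n 0 0
  simp only [zero_add] at h
  have e1 : ∑ k ∈ Finset.range (n + 1), (n.choose k : ℝ) * maxLik k (n - k)
      = (∑ k ∈ Finset.range (n + 1), (n.choose k : ℝ) * k ^ k * ((n - k : ℕ) : ℝ) ^ (n - k)) / n ^ n := by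
    rw [Finset.sum_div]
    refine Finset.sum_congr rfl fun k hk => ?_
    have hk' : k ≤ n := Nat.lt_succ_iff.mp (Finset.mem_range.mp hk)
    have : k + (n - k) = n := by omega
    rw [maxLik, this, div_pow, div_pow, div_mul_div_comm, ← pow_add, this, mul_div_assoc', mul_assoc]
  rw [e1, h, Finset.sum_div]
  refine Finset.sum_congr rfl fun j hj => ?_
  have hj' : j ≤ n := Nat.lt_succ_iff.mp (Finset.mem_range.mp hj)
  have : (n : ℝ) ^ n = n ^ (n - j) * n ^ j := by rw [← pow_add]; congr 1; omega
  rw [this]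
  field_simp

theorem maxLik_nonneg (k l : ℕ) : 0 ≤ maxLik k l := by
  rw [maxLik]; positivity

theorem maxLik_pos (k l : ℕ) : 0 < maxLik k l := by
  rw [maxLik]
  refine mul_pos ?_ ?_
  · rcases Nat.eq_zero_or_pos k with rfl | hk
    · simp
    · have : 0 < k + l := by omega
      positivity
  · rcases Nat.eq_zero_or_pos l with rfl | hl
    · simp
    · have : 0 < k + l := by omega
      positivity

theorem maxLik_zero_left (l : ℕ) : maxLik 0 l = 1 := by
  rcases Nat.eq_zero_or_pos l with rfl | hl
  · simp [maxLik]
  · have : (l : ℝ) ≠ 0 := by exact_mod_cast hl.ne'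
    simp [maxLik, this]

theorem maxLik_zero_right (k : ℕ) : maxLik k 0 = 1 := by
  rcases Nat.eq_zero_or_pos k with rfl | hl
  · simp [maxLik]
  · have : (k : ℝ) ≠ 0 := by exact_mod_cast hl.ne'
    simp [maxLik, this]

/-- Apply `1 + x ≤ exp x` to the ratios of `θ` and `1 - θ` to the observed frequencies: the
exponents cancel. -/
theorem pow_mul_one_sub_pow_le_maxLik {θ : ℝ} (h0 : 0 ≤ θ) (h1 : θ ≤ 1) (k l : ℕ) :
    θ ^ k * (1 - θ) ^ l ≤ maxLik k l := by
  rcases Nat.eq_zero_or_pos k with rfl | hk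
  · rw [maxLik_zero_left, pow_zero, one_mul]
    exact pow_le_one₀ (by linarith) (by linarith)
  rcases Nat.eq_zero_or_pos l with rfl | hl
  · rw [maxLik_zero_right, pow_zero, mul_one]
    exact pow_le_one₀ h0 h1
  have hk' : (0 : ℝ) < k := by exact_mod_cast hk
  have hl' : (0 : ℝ) < l := by exact_mod_cast hl
  have key : ∀ (a c : ℝ) (j : ℕ), 0 ≤ a → 0 < c → a ^ j ≤ c ^ j * Real.exp (j * (a / c - 1)) := by
    intro a c j ha hc
    rw [Real.exp_nat_mul, ← mul_pow]
    refine pow_le_pow_left₀ ha ?_ j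
    have := Real.add_one_le_exp (a / c - 1)
    calc a = c * (a / c - 1 + 1) := by field_simp; ring
      _ ≤ _ := by gcongr
  have hq : (0 : ℝ) < k / (k + l : ℕ) := by positivity
  have hr : (0 : ℝ) < l / (k + l : ℕ) := by positivity
  calc θ ^ k * (1 - θ) ^ l
      ≤ ((k / (k + l : ℕ) : ℝ) ^ k * Real.exp (k * (θ / (k / (k + l : ℕ)) - 1)))
        * ((l / (k + l : ℕ) : ℝ) ^ l * Real.exp (l * ((1 - θ) / (l / (k + l : ℕ)) - 1))) := by
        have := key θ _ k h0 hq
        have := key (1 - θ) _ l (by linarith) hr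
        have : 0 ≤ (1 - θ) ^ l := pow_nonneg (by linarith) l
        gcongr
    _ = maxLik k l * Real.exp (k * (θ / (k / (k + l : ℕ)) - 1)
        + l * ((1 - θ) / (l / (k + l : ℕ)) - 1)) := by
        rw [Real.exp_add, maxLik]; ring
    _ = maxLik k l := by
        rw [show (k : ℝ) * (θ / (k / (k + l : ℕ)) - 1) + l * ((1 - θ) / (l / (k + l : ℕ)) - 1) = 0 by
          push_cast; field_simp; ring]
        simp

/-! ### Exponential moment for the binary relative entropy -/

/-- The tangent functional `q log t + (1 - q) log u - (p t + (1 - p) u) + 1`, whose supremum over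
`t, u > 0` is `kl(q | p)`. -/
noncomputable def klTangent (t u q p : ℝ) : ℝ :=
  q * Real.log t + (1 - q) * Real.log u - (p * t + (1 - p) * u) + 1

/-- A mixture over Bernoulli outcomes that dominates `exp (m kl(mean x | p))`. -/
noncomputable def klMixture {m : ℕ} (p : ℝ) (x : Fin m → ℝ) : ENNReal :=
  ∑ T ∈ (Finset.univ : Finset (Fin m)).powerset,
    ENNReal.ofReal (maxLik T.card (m - T.card)) * (ENNReal.ofReal p)⁻¹ ^ T.card
      * (ENNReal.ofReal (1 - p))⁻¹ ^ (m - T.card)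
      * ((∏ j ∈ T, ENNReal.ofReal (x j)) * ∏ j ∈ Finset.univ \ T, ENNReal.ofReal (1 - x j))

theorem convexComb_pos {p t u : ℝ} (hp : p ∈ Set.Icc (0 : ℝ) 1) (ht : 0 < t) (hu : 0 < u) :
    0 < p * t + (1 - p) * u := by
  rcases hp.1.eq_or_lt with rfl | h
  · simpa using hu
  · have := mul_pos h ht
    have := mul_nonneg (sub_nonneg.mpr hp.2) hu.le
    linarith

/-- With `w = p t + (1 - p) u` and `θ = p t / w`, the ratios are `θ / p` and `(1 - θ) / (1 - p)`, so
the maximal likelihood removes `t, u`. For `p` equal to `0` or `1` the right side is infinite unless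
the critical exponent is zero. -/
theorem ofReal_pow_mul_pow_le {p t u : ℝ} (hp : p ∈ Set.Icc (0 : ℝ) 1) (ht : 0 < t) (hu : 0 < u)
    (k l : ℕ) :
    ENNReal.ofReal ((t / (p * t + (1 - p) * u)) ^ k * (u / (p * t + (1 - p) * u)) ^ l)
      ≤ ENNReal.ofReal (maxLik k l) * (ENNReal.ofReal p)⁻¹ ^ k * (ENNReal.ofReal (1 - p))⁻¹ ^ l := by
  have hML : ENNReal.ofReal (maxLik k l) ≠ 0 := by simpa using maxLik_pos k l
  rcases hp.1.eq_or_lt with rfl | h0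
  · rcases Nat.eq_zero_or_pos k with rfl | hk
    · simp [maxLik_zero_left, hu.ne']
    · simp [ENNReal.top_pow hk.ne', ENNReal.mul_top hML]
  rcases hp.2.eq_or_lt with rfl | h1
  · rcases Nat.eq_zero_or_pos l with rfl | hl
    · simp [maxLik_zero_right, ht.ne']
    · simp [ENNReal.top_pow hl.ne', ENNReal.mul_top hML]
  have h1' : 0 < 1 - p := sub_pos.mpr h1
  have hw := convexComb_pos hp ht hu
  set w := p * t + (1 - p) * u with hwdef
  rw [← ENNReal.ofReal_inv_of_pos h0, ← ENNReal.ofReal_inv_of_pos h1',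
    ← ENNReal.ofReal_pow (by positivity), ← ENNReal.ofReal_pow (by positivity),
    ← ENNReal.ofReal_mul (maxLik_nonneg k l),
    ← ENNReal.ofReal_mul (mul_nonneg (maxLik_nonneg k l) (by positivity))]
  refine ENNReal.ofReal_le_ofReal ?_
  have hθ1 : 1 - p * t / w = (1 - p) * u / w := by rw [hwdef] at hw ⊢; field_simp; ring
  have hθ : p * t / w ≤ 1 := by
    have : 0 ≤ (1 - p) * u / w := by positivity
    linarith
  have := pow_mul_one_sub_pow_le_maxLik (by positivity : 0 ≤ p * t / w) hθ k l
  calc (t / w) ^ k * (u / w) ^ l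
      = ((p * t / w) ^ k * (1 - p * t / w) ^ l) * p⁻¹ ^ k * (1 - p)⁻¹ ^ l := by
        rw [hθ1, mul_div_assoc, mul_div_assoc, mul_pow, mul_pow, inv_pow, inv_pow]
        field_simp
    _ ≤ _ := by gcongr

/-- Weighted AM–GM gives `t^x u^(1-x) ≤ x t + (1 - x) u`, and the remaining factor satisfies `exp (1
- w) ≤ 1 / w`. -/
theorem exp_klTangent_le {p t u x : ℝ} (hp : p ∈ Set.Icc (0 : ℝ) 1) (ht : 0 < t) (hu : 0 < u)
    (hx : x ∈ Set.Icc (0 : ℝ) 1) :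
    Real.exp (klTangent t u x p)
      ≤ x * (t / (p * t + (1 - p) * u)) + (1 - x) * (u / (p * t + (1 - p) * u)) := by
  have hw := convexComb_pos hp ht hu
  set w := p * t + (1 - p) * u with hwdef
  have h1 : Real.exp (x * Real.log t + (1 - x) * Real.log u) ≤ x * t + (1 - x) * u := by
    have := convexOn_exp.2 (Set.mem_univ (Real.log t)) (Set.mem_univ (Real.log u)) hx.1
      (sub_nonneg.mpr hx.2) (by ring)
    simpa [Real.exp_log ht, Real.exp_log hu] using this
  have h2 : Real.exp (1 - w) ≤ 1 / w := by
    rw [le_div_iff₀ hw]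
    calc Real.exp (1 - w) * w ≤ Real.exp (1 - w) * Real.exp (w - 1) := by
          gcongr; linarith [Real.add_one_le_exp (w - 1)]
      _ = 1 := by rw [← Real.exp_add]; simp
  calc Real.exp (klTangent t u x p)
      = Real.exp (x * Real.log t + (1 - x) * Real.log u) * Real.exp (1 - w) := by
        rw [← Real.exp_add, klTangent]; congr 1; ring
    _ ≤ (x * t + (1 - x) * u) * (1 / w) :=
        mul_le_mul h1 h2 (Real.exp_pos _).le ((Real.exp_pos _).le.trans h1)
    _ = _ := by ring

/-- Expanding the product of the one-sample bounds over subsets isolates the powers of `t / w` and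
`u / w`, which are then bounded uniformly in `t, u`. -/
theorem ofReal_exp_sum_klTangent_le {m : ℕ} {p t u : ℝ} {x : Fin m → ℝ}
    (hp : p ∈ Set.Icc (0 : ℝ) 1) (ht : 0 < t) (hu : 0 < u) (hx : ∀ j, x j ∈ Set.Icc (0 : ℝ) 1) :
    ENNReal.ofReal (Real.exp (∑ j, klTangent t u (x j) p)) ≤ klMixture p x := by
  have hw := convexComb_pos hp ht hu
  have hx1 : ∀ j, 0 ≤ 1 - x j := fun j => sub_nonneg.mpr (hx j).2
  calc ENNReal.ofReal (Real.exp (∑ j, klTangent t u (x j) p))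
      ≤ ENNReal.ofReal (∏ j, (x j * (t / (p * t + (1 - p) * u))
          + (1 - x j) * (u / (p * t + (1 - p) * u)))) := by
        rw [Real.exp_sum]
        exact ENNReal.ofReal_le_ofReal (Finset.prod_le_prod (fun j _ => (Real.exp_pos _).le)
          fun j _ => exp_klTangent_le hp ht hu (hx j))
    _ = ∑ T ∈ (Finset.univ : Finset (Fin m)).powerset,
          ENNReal.ofReal ((t / (p * t + (1 - p) * u)) ^ T.card
            * (u / (p * t + (1 - p) * u)) ^ (m - T.card))
          * ((∏ j ∈ T, ENNReal.ofReal (x j)) * ∏ j ∈ Finset.univ \ T, ENNReal.ofReal (1 - x j)) := by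
        rw [Finset.prod_add, ENNReal.ofReal_sum_of_nonneg]
        · refine Finset.sum_congr rfl fun T _ => ?_
          rw [← ENNReal.ofReal_prod_of_nonneg fun j _ => (hx j).1,
            ← ENNReal.ofReal_prod_of_nonneg fun j _ => hx1 j,
            ← ENNReal.ofReal_mul (Finset.prod_nonneg fun j _ => (hx j).1),
            ← ENNReal.ofReal_mul (by positivity)]
          congr 1
          simp only [Finset.prod_mul_distrib, Finset.prod_const,
            Finset.card_sdiff_of_subset (Finset.subset_univ T), Finset.card_univ, Fintype.card_fin]
          ring
        · intro T _
          exact mul_nonneg (Finset.prod_nonneg fun j _ => mul_nonneg (hx j).1 (by positivity))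
            (Finset.prod_nonneg fun j _ => mul_nonneg (hx1 j) (by positivity))
    _ ≤ klMixture p x := by
        refine Finset.sum_le_sum fun T _ => ?_
        gcongr
        exact ofReal_pow_mul_pow_le hp ht hu _ _

theorem measurable_klMixture {α : Type*} [MeasurableSpace α] {m : ℕ} {p : α → ℝ}
    {x : α → Fin m → ℝ} (hp : Measurable p) (hx : ∀ j, Measurable fun a => x a j) :
    Measurable fun a => klMixture (p a) (x a) := by
  unfold klMixture
  refine Finset.measurable_sum _ fun T _ => ?_
  refine ((measurable_const.mul (hp.ennreal_ofReal.inv.pow_const _)).mul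
    ((measurable_const.sub hp).ennreal_ofReal.inv.pow_const _)).mul ?_
  exact (Finset.measurable_prod _ fun j _ => (hx j).ennreal_ofReal).mul
    (Finset.measurable_prod _ fun j _ => (measurable_const.sub (hx j)).ennreal_ofReal)

theorem lintegral_pi_prod {ι : Type*} [Fintype ι] {X : ι → Type*} [∀ i, MeasurableSpace (X i)]
    (μ : ∀ i, Measure (X i)) [∀ i, IsProbabilityMeasure (μ i)] {f : ∀ i, X i → ENNReal}
    (hf : ∀ i, Measurable (f i)) :
    ∫⁻ x, ∏ i, f i (x i) ∂Measure.pi μ = ∏ i, ∫⁻ a, f i a ∂μ i := by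
  have hind : iIndepFun (fun i (x : ∀ i, X i) => f i (x i)) (Measure.pi μ) :=
    iIndepFun_pi fun i => (hf i).aemeasurable
  rw [lintegral_prod_eq_prod_lintegral_of_indepFun Finset.univ _ hind
    fun i => (hf i).comp (measurable_pi_apply i)]
  refine Finset.prod_congr rfl fun i _ => ?_
  exact (measurePreserving_eval μ i).lintegral_comp (hf i)

/-- By independence the product attached to `T` has mean `p^|T| (1 - p)^(m - |T|)`, which the
inverse powers cancel, leaving the binomial sum of `maxLik`. -/
theorem lintegral_klMixture_le {Z : Type*} [MeasurableSpace Z] (D : Measure Z)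
    [IsProbabilityMeasure D] {m : ℕ} (hm : 1 ≤ m) {g : Z → ℝ} (hg : Measurable g)
    (hg1 : ∀ z, g z ∈ Set.Icc (0 : ℝ) 1) :
    ∫⁻ s, klMixture (∫ z, g z ∂D) (fun j => g (s j)) ∂(Measure.pi fun _ : Fin m => D)
      ≤ ENNReal.ofReal (2 * √m) := by
  have hint : Integrable g D := Integrable.of_mem_Icc 0 1 hg.aemeasurable (ae_of_all _ hg1)
  have h1 : ∫⁻ z, ENNReal.ofReal (g z) ∂D = ENNReal.ofReal (∫ z, g z ∂D) :=
    (ofReal_integral_eq_lintegral_ofReal hint (ae_of_all _ fun z => (hg1 z).1)).symm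
  have h2 : ∫⁻ z, ENNReal.ofReal (1 - g z) ∂D = ENNReal.ofReal (1 - ∫ z, g z ∂D) := by
    have hsub : Integrable (fun z => 1 - g z) D := (integrable_const 1).sub hint
    rw [← ofReal_integral_eq_lintegral_ofReal hsub
      (ae_of_all _ fun z => sub_nonneg.mpr (hg1 z).2), integral_sub (integrable_const 1) hint]
    simp
  set p := ∫ z, g z ∂D
  have hmono : ∀ T : Finset (Fin m), ∫⁻ s : Fin m → Z, ((∏ j ∈ T, ENNReal.ofReal (g (s j)))
      * ∏ j ∈ Finset.univ \ T, ENNReal.ofReal (1 - g (s j))) ∂(Measure.pi fun _ : Fin m => D)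
      = ENNReal.ofReal p ^ T.card * ENNReal.ofReal (1 - p) ^ (m - T.card) := by
    intro T
    classical
    have hmeas : ∀ j : Fin m, Measurable fun z =>
        if j ∈ T then ENNReal.ofReal (g z) else ENNReal.ofReal (1 - g z) := by
      intro j
      split_ifs
      · exact hg.ennreal_ofReal
      · exact (measurable_const.sub hg).ennreal_ofReal
    have := lintegral_pi_prod (fun _ : Fin m => D) hmeas
    have hsplit : ∀ a b : Fin m → ENNReal, (∏ j, if j ∈ T then a j else b j)
        = (∏ j ∈ T, a j) * ∏ j ∈ Finset.univ \ T, b j := by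
      intro a b
      rw [Finset.prod_ite]
      congr 2 <;> ext j <;> simp
    have hI : ∀ j : Fin m, ∫⁻ z, (if j ∈ T then ENNReal.ofReal (g z) else ENNReal.ofReal (1 - g z)) ∂D
        = if j ∈ T then ENNReal.ofReal p else ENNReal.ofReal (1 - p) := by
      intro j
      split_ifs
      · exact h1
      · exact h2
    simp only [hsplit, hI] at this
    rw [this]
    simp [Finset.card_sdiff_of_subset (Finset.subset_univ T)]
  unfold klMixture
  have hmeasT : ∀ T : Finset (Fin m), Measurable fun s : Fin m → Z =>
      (∏ j ∈ T, ENNReal.ofReal (g (s j)))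
      * ∏ j ∈ Finset.univ \ T, ENNReal.ofReal (1 - g (s j)) := fun T =>
    (Finset.measurable_prod _ fun j _ => (hg.comp (measurable_pi_apply j)).ennreal_ofReal).mul
    (Finset.measurable_prod _ fun j _ =>
      (measurable_const.sub (hg.comp (measurable_pi_apply j))).ennreal_ofReal)
  rw [lintegral_finsetSum _ fun T _ => (hmeasT T).const_mul _]
  calc _ ≤ ∑ T ∈ (Finset.univ : Finset (Fin m)).powerset,
        ENNReal.ofReal (maxLik T.card (m - T.card)) := by
        refine Finset.sum_le_sum fun T _ => ?_
        rw [lintegral_const_mul _ (hmeasT T), hmono T]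
        calc _ = ENNReal.ofReal (maxLik T.card (m - T.card))
              * ((ENNReal.ofReal p)⁻¹ * ENNReal.ofReal p) ^ T.card
              * ((ENNReal.ofReal (1 - p))⁻¹ * ENNReal.ofReal (1 - p)) ^ (m - T.card) := by
              simp only [mul_pow]; ring
          -- Only an inequality, since `0⁻¹ * 0 = 0` in `ENNReal` when `p` is `0` or `1`.
          _ ≤ ENNReal.ofReal (maxLik T.card (m - T.card)) * 1 ^ T.card * 1 ^ (m - T.card) := by
              gcongr <;> exact ENNReal.inv_mul_le_one _
          _ = _ := by simp
    _ = ENNReal.ofReal (∑ k ∈ Finset.range (m + 1), (m.choose k : ℝ) * maxLik k (m - k)) := by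
        rw [← ENNReal.ofReal_sum_of_nonneg fun T _ => maxLik_nonneg _ _,
          Finset.sum_powerset_apply_card fun k => maxLik k (m - k)]
        simp
    _ ≤ _ := ENNReal.ofReal_le_ofReal (sum_choose_mul_maxLik_le hm)

/-! ### Change of measure and the uniform event -/

/-- The Donsker–Varadhan change of measure inequality for bounded functions. -/
theorem integral_le_klDiv_add_log {α : Type*} [MeasurableSpace α] {μ ν : Measure α}
    [IsProbabilityMeasure μ] [IsProbabilityMeasure ν] (hkl : InformationTheory.klDiv μ ν ≠ ⊤)
    {f : α → ℝ} (hf : Measurable f) {B : ℝ} (hB : ∀ a, |f a| ≤ B) :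
    ∫ a, f a ∂μ ≤ (InformationTheory.klDiv μ ν).toReal + Real.log (∫ a, Real.exp (f a) ∂ν) := by
  obtain ⟨hac, hllr⟩ := InformationTheory.klDiv_ne_top_iff.mp hkl
  have hfμ : Integrable f μ := Integrable.of_bound hf.aestronglyMeasurable B (ae_of_all _ hB)
  have hfν : Integrable (fun a => Real.exp (f a)) ν :=
    Integrable.of_bound hf.exp.aestronglyMeasurable (Real.exp B) (ae_of_all _ fun a => by
      rw [Real.norm_eq_abs, Real.abs_exp]
      exact Real.exp_le_exp.mpr ((le_abs_self _).trans (hB a)))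
  -- The inequality is nonnegativity of the divergence of `μ` from `ν` tilted by `f`.
  have : IsProbabilityMeasure (ν.tilted f) := isProbabilityMeasure_tilted hfν
  have h1 := integral_llr_tilted_right hac hfμ hfν hllr
  have h2 := InformationTheory.integral_llr_add_sub_measure_univ_nonneg
    (hac.trans (absolutelyContinuous_tilted hfν)) (integrable_llr_tilted_right hac hfμ hllr hfν)
  rw [InformationTheory.toReal_klDiv_of_measure_eq hac (by simp)]
  simp only [probReal_univ] at h2
  linarith

section Joint

variable {n : ℕ} {F : Type*} [MeasurableSpace F]

instance isProbabilityMeasure_jointPrior (hyperPrior : ProbabilityMeasure (ProbabilityMeasure F)) :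
    IsProbabilityMeasure (jointPrior n hyperPrior) := by
  unfold jointPrior; infer_instance

instance isProbabilityMeasure_jointPosterior
    (hyperPost : ProbabilityMeasure (ProbabilityMeasure F)) (Q : Fin n → ProbabilityMeasure F) :
    IsProbabilityMeasure (jointPosterior hyperPost Q) := by
  unfold jointPosterior; infer_instance

theorem measurePreserving_jointPosterior
    (hyperPost : ProbabilityMeasure (ProbabilityMeasure F)) (Q : Fin n → ProbabilityMeasure F)
    (i : Fin n) :
    MeasurePreserving (fun x : ProbabilityMeasure F × (Fin n → F) => x.2 i)
      (jointPosterior hyperPost Q) (Q i : Measure F) :=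
  (measurePreserving_eval (fun i => (Q i : Measure F)) i).comp measurePreserving_snd

theorem integral_sum_jointPosterior
    (hyperPost : ProbabilityMeasure (ProbabilityMeasure F)) (Q : Fin n → ProbabilityMeasure F)
    {φ : Fin n → F → ℝ} (hφ : ∀ i, Integrable (φ i) (Q i : Measure F)) :
    ∫ x, ∑ i, φ i (x.2 i) ∂(jointPosterior hyperPost Q) = ∑ i, ∫ f, φ i f ∂(Q i : Measure F) := by
  have hmp := measurePreserving_jointPosterior hyperPost Q
  have hint : ∀ i, Integrable (fun x : ProbabilityMeasure F × (Fin n → F) => φ i (x.2 i))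
      (jointPosterior hyperPost Q) := fun i => (hmp i).integrable_comp_of_integrable (hφ i)
  rw [integral_finsetSum _ fun i _ => hint i]
  refine Finset.sum_congr rfl fun i _ => ?_
  rw [← (hmp i).map_eq, integral_map (hmp i).measurable.aemeasurable]
  rw [(hmp i).map_eq]
  exact (hφ i).aestronglyMeasurable

end Joint

instance isProbabilityMeasure_dataLaw {n : ℕ} {Z : Fin n → Type*} [∀ i, MeasurableSpace (Z i)]
    (m : Fin n → ℕ) (D : ∀ i, ProbabilityMeasure (Z i)) : IsProbabilityMeasure (dataLaw m D) := by
  unfold dataLaw; infer_instance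

/-- A PAC-Bayes bound for exponential moments `G i` that are controlled in expectation over the data
of task `i`, uniformly over the model. -/
theorem exists_event_integral_le {n : ℕ} {F : Type*} [MeasurableSpace F]
    {Z : Fin n → Type*} [∀ i, MeasurableSpace (Z i)] (m : Fin n → ℕ)
    (D : ∀ i, ProbabilityMeasure (Z i)) (hyperPrior : ProbabilityMeasure (ProbabilityMeasure F))
    (G : ∀ i, F → (Fin (m i) → Z i) → ENNReal) (hG : ∀ i, Measurable (Function.uncurry (G i)))
    (C : Fin n → ℝ) (hC : ∀ i, 0 < C i)
    (hGC : ∀ i f, ∫⁻ s, G i f s ∂(Measure.pi fun _ : Fin (m i) => (D i : Measure (Z i)))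
      ≤ ENNReal.ofReal (C i))
    {δ : ℝ} (hδ : 0 < δ) :
    ∃ E : Set (∀ i, Fin (m i) → Z i), MeasurableSet E ∧ 1 - δ ≤ (dataLaw m D).real E ∧
      ∀ S ∈ E, ∀ (hyperPost : ProbabilityMeasure (ProbabilityMeasure F))
        (Q : Fin n → ProbabilityMeasure F),
        InformationTheory.klDiv (jointPosterior hyperPost Q) (jointPrior n hyperPrior) ≠ ⊤ →
        ∀ φ : Fin n → F → ℝ, (∀ i, Measurable (φ i)) → (∀ i, ∃ B, ∀ f, |φ i f| ≤ B) →
          (∀ i f, ENNReal.ofReal (Real.exp (φ i f)) ≤ G i f (S i)) →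
          ∑ i, ∫ f, φ i f ∂(Q i : Measure F)
            ≤ (InformationTheory.klDiv (jointPosterior hyperPost Q) (jointPrior n hyperPrior)).toReal
              + (Real.log (1 / δ) + ∑ i, Real.log (C i)) := by
  set ν := jointPrior n hyperPrior with hν
  set W : (ProbabilityMeasure F × (Fin n → F)) → (∀ i, Fin (m i) → Z i) → ENNReal :=
    fun x S => ∏ i, G i (x.2 i) (S i) with hW
  have hWm : Measurable (Function.uncurry W) := by
    refine Finset.measurable_prod _ fun i _ => ?_
    refine (hG i).comp (Measurable.prodMk ?_ ?_)
    · exact (measurable_pi_apply i).comp (measurable_snd.comp measurable_fst)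
    · exact (measurable_pi_apply i).comp measurable_snd
  have hZm : Measurable fun S => ∫⁻ x, W x S ∂ν := hWm.lintegral_prod_left'
  have hCprod : 0 < ∏ i, C i := Finset.prod_pos fun i _ => hC i
  have hEW : ∫⁻ S, ∫⁻ x, W x S ∂ν ∂(dataLaw m D) ≤ ENNReal.ofReal (∏ i, C i) := by
    -- The prior does not depend on the data, so the data can be integrated first; for fixed models
    -- the expectation then factors over tasks.
    rw [lintegral_lintegral_swap (f := fun S x => W x S)
      (hWm.comp measurable_swap).aemeasurable]
    calc ∫⁻ x, ∫⁻ S, W x S ∂(dataLaw m D) ∂ν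
        ≤ ∫⁻ x, ENNReal.ofReal (∏ i, C i) ∂ν := by
          refine lintegral_mono fun x => ?_
          rw [ENNReal.ofReal_prod_of_nonneg fun i _ => (hC i).le, dataLaw, hW]
          refine (lintegral_pi_prod _ fun i => ?_).trans_le
            (Finset.prod_le_prod' fun i _ => hGC i (x.2 i))
          exact (hG i).comp measurable_prodMk_left
      _ = _ := by simp
  have hCδ : 0 < (∏ i, C i) / δ := by positivity
  -- The bad event for Markov's inequality. It involves neither posteriors nor `φ`, so both may
  -- depend on the data.
  set A : Set (∀ i, Fin (m i) → Z i) := {S | ENNReal.ofReal ((∏ i, C i) / δ) ≤ ∫⁻ x, W x S ∂ν}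
    with hA
  have hAm : MeasurableSet A := measurableSet_le measurable_const hZm
  have hAδ : (dataLaw m D).real A ≤ δ := by
    refine ENNReal.toReal_le_of_le_ofReal hδ.le ?_
    have h := (mul_meas_ge_le_lintegral hZm (ENNReal.ofReal ((∏ i, C i) / δ))).trans hEW
    rw [show ENNReal.ofReal (∏ i, C i) = ENNReal.ofReal ((∏ i, C i) / δ) * ENNReal.ofReal δ by
      rw [← ENNReal.ofReal_mul hCδ.le]; congr 1; field_simp] at h
    exact (ENNReal.mul_le_mul_iff_right (by simpa using hCδ) ENNReal.ofReal_ne_top).mp h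
  refine ⟨Aᶜ, hAm.compl, ?_, ?_⟩
  · rw [probReal_compl_eq_one_sub hAm]; linarith
  intro S hS hyperPost Q hkl φ hφ hφB hφG
  choose B hB using hφB
  have hSlt : ∫⁻ x, W x S ∂ν < ENNReal.ofReal ((∏ i, C i) / δ) := not_le.mp hS
  set ψ : ProbabilityMeasure F × (Fin n → F) → ℝ := fun x => ∑ i, φ i (x.2 i) with hψ
  have hψm : Measurable ψ := Finset.measurable_sum _ fun i _ =>
    (hφ i).comp ((measurable_pi_apply i).comp measurable_snd)
  have hψB : ∀ x, |ψ x| ≤ ∑ i, B i := fun x =>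
    (Finset.abs_sum_le_sum_abs _ _).trans (Finset.sum_le_sum fun i _ => hB i _)
  have hdv := integral_le_klDiv_add_log hkl hψm hψB
  rw [hψ, integral_sum_jointPosterior hyperPost Q fun i =>
    Integrable.of_bound (hφ i).aestronglyMeasurable (B i) (ae_of_all _ (hB i))] at hdv
  refine hdv.trans (add_le_add_right ?_ _)
  have hexp_int : Integrable (fun x => Real.exp (ψ x)) ν :=
    Integrable.of_bound hψm.exp.aestronglyMeasurable (Real.exp (∑ i, B i)) (ae_of_all _ fun x => by
      rw [Real.norm_eq_abs, Real.abs_exp]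
      exact Real.exp_le_exp.mpr ((le_abs_self _).trans (hψB x)))
  have hexp_le : ∫ x, Real.exp (ψ x) ∂ν ≤ (∏ i, C i) / δ := by
    rw [integral_eq_lintegral_of_nonneg_ae (ae_of_all _ fun x => (Real.exp_pos _).le)
      hexp_int.aestronglyMeasurable]
    refine ENNReal.toReal_le_of_le_ofReal hCδ.le (le_trans (lintegral_mono fun x => ?_) hSlt.le)
    simp only [hψ, hW, Real.exp_sum]
    rw [ENNReal.ofReal_prod_of_nonneg fun i _ => (Real.exp_pos _).le]
    exact Finset.prod_le_prod' fun i _ => hφG i _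
  calc Real.log (∫ x, Real.exp (ψ x) ∂ν) ≤ Real.log ((∏ i, C i) / δ) :=
        Real.log_le_log (integral_exp_pos hexp_int) hexp_le
    _ = _ := by
        rw [Real.log_div hCprod.ne' hδ.ne', Real.log_prod fun i _ => (hC i).ne', one_div,
          Real.log_inv]
        ring

/-! ### Posterior averages of affine statistics -/

section Affine

variable {F Z : Type*} [MeasurableSpace F] [MeasurableSpace Z]

theorem integral_integral_loss (D : ProbabilityMeasure Z) (Q : ProbabilityMeasure F)
    {ℓ : F → Z → ℝ} (hℓ : Measurable (Function.uncurry ℓ)) (h1 : ∀ f z, ℓ f z ∈ Set.Icc (0 : ℝ) 1) :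
    ∫ f, ∫ z, ℓ f z ∂(D : Measure Z) ∂(Q : Measure F) = risk D ℓ Q := by
  unfold risk gibbsLoss
  exact integral_integral_swap
    (Integrable.of_mem_Icc 0 1 hℓ.aemeasurable (ae_of_all _ fun x => h1 x.1 x.2))

theorem integral_mem_Icc {α : Type*} [MeasurableSpace α] (μ : Measure α) [IsProbabilityMeasure μ]
    {g : α → ℝ} (h1 : ∀ a, g a ∈ Set.Icc (0 : ℝ) 1) : ∫ a, g a ∂μ ∈ Set.Icc (0 : ℝ) 1 := by
  refine ⟨integral_nonneg fun a => (h1 a).1, ?_⟩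
  have := integral_mono_of_nonneg (μ := μ) (ae_of_all _ fun a => (h1 a).1) (integrable_const (1 : ℝ))
    (ae_of_all _ fun a => (h1 a).2)
  simpa using this

theorem risk_mem_Icc (D : ProbabilityMeasure Z) (Q : ProbabilityMeasure F)
    {ℓ : F → Z → ℝ} (h1 : ∀ f z, ℓ f z ∈ Set.Icc (0 : ℝ) 1) : risk D ℓ Q ∈ Set.Icc (0 : ℝ) 1 :=
  integral_mem_Icc _ fun z => integral_mem_Icc _ fun f => h1 f z

/-- Linearity and Fubini give equality, so no joint convexity or Jensen step is needed. -/
theorem integral_sum_affine_loss (D : ProbabilityMeasure Z) (Q : ProbabilityMeasure F)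
    {ℓ : F → Z → ℝ} (hℓ : Measurable (Function.uncurry ℓ)) (h1 : ∀ f z, ℓ f z ∈ Set.Icc (0 : ℝ) 1)
    {m : ℕ} (hm : 1 ≤ m) (s : Fin m → Z) (a b c : ℝ) :
    ∫ f, ∑ j, (a * ℓ f (s j) + b * ∫ z, ℓ f z ∂(D : Measure Z) + c) ∂(Q : Measure F)
      = m * (a * empRisk ℓ s Q + b * risk D ℓ Q + c) := by
  have hm0 : (m : ℝ) ≠ 0 := by exact_mod_cast (by omega : m ≠ 0)
  have hI1 : ∀ j, Integrable (fun f => a * ℓ f (s j)) (Q : Measure F) := fun j =>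
    (Integrable.of_mem_Icc 0 1 (hℓ.comp measurable_prodMk_right).aemeasurable
      (ae_of_all _ fun f => h1 f (s j))).const_mul a
  have hR : Measurable fun f => ∫ z, ℓ f z ∂(D : Measure Z) :=
    (hℓ.stronglyMeasurable.integral_prod_right (ν := (D : Measure Z))).measurable
  have hI2 : Integrable (fun f => b * ∫ z, ℓ f z ∂(D : Measure Z)) (Q : Measure F) :=
    (Integrable.of_mem_Icc 0 1 hR.aemeasurable
      (ae_of_all _ fun f => integral_mem_Icc _ (h1 f))).const_mul b
  have hI12 : ∀ j, Integrable (fun f => a * ℓ f (s j) + b * ∫ z, ℓ f z ∂(D : Measure Z))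
      (Q : Measure F) := fun j => (hI1 j).add hI2
  have hI : ∀ j, Integrable (fun f => a * ℓ f (s j) + b * ∫ z, ℓ f z ∂(D : Measure Z) + c)
      (Q : Measure F) := fun j => (hI12 j).add (integrable_const c)
  rw [integral_finsetSum _ fun j _ => hI j]
  have : ∀ j, ∫ f, (a * ℓ f (s j) + b * ∫ z, ℓ f z ∂(D : Measure Z) + c) ∂(Q : Measure F)
      = a * gibbsLoss ℓ Q (s j) + b * risk D ℓ Q + c := by
    intro j
    rw [integral_add (hI12 j) (integrable_const c), integral_add (hI1 j) hI2, integral_const_mul,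
      integral_const_mul, integral_integral_loss D Q hℓ h1]
    simp [gibbsLoss]
  simp only [this, Finset.sum_add_distrib, ← Finset.mul_sum, Finset.sum_const, Finset.card_univ,
    Fintype.card_fin, nsmul_eq_mul, empRisk]
  field_simp

end Affine

theorem empRisk_mem_Icc {F Z : Type*} [MeasurableSpace F] {m : ℕ} (hm : 1 ≤ m) (s : Fin m → Z)
    (Q : ProbabilityMeasure F)
    {ℓ : F → Z → ℝ} (h1 : ∀ f z, ℓ f z ∈ Set.Icc (0 : ℝ) 1) :
    empRisk ℓ s Q ∈ Set.Icc (0 : ℝ) 1 := by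
  have hm0 : (0 : ℝ) < m := by exact_mod_cast hm
  have h : ∀ j, gibbsLoss ℓ Q (s j) ∈ Set.Icc (0 : ℝ) 1 := fun j =>
    integral_mem_Icc _ fun f => h1 f (s j)
  refine ⟨mul_nonneg (by positivity) (Finset.sum_nonneg fun j _ => (h j).1), ?_⟩
  rw [empRisk, one_div, inv_mul_le_iff₀ hm0, mul_one]
  simpa using Finset.sum_le_sum fun j (_ : j ∈ Finset.univ) => (h j).2

/-- The PAC-Bayes bound for statistics that are affine in the sample losses and in the risk. -/
theorem exists_event_affine_le {n : ℕ} {F : Type*} [MeasurableSpace F]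
    {Z : Fin n → Type*} [∀ i, MeasurableSpace (Z i)] (m : Fin n → ℕ) (hm : ∀ i, 1 ≤ m i)
    (D : ∀ i, ProbabilityMeasure (Z i)) (ℓ : ∀ i, F → Z i → ℝ)
    (hℓ : ∀ i, Measurable (Function.uncurry (ℓ i)))
    (h1 : ∀ i f z, ℓ i f z ∈ Set.Icc (0 : ℝ) 1)
    (hyperPrior : ProbabilityMeasure (ProbabilityMeasure F))
    (G : ∀ i, F → (Fin (m i) → Z i) → ENNReal) (hG : ∀ i, Measurable (Function.uncurry (G i)))
    (C : Fin n → ℝ) (hC : ∀ i, 0 < C i)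
    (hGC : ∀ i f, ∫⁻ s, G i f s ∂(Measure.pi fun _ : Fin (m i) => (D i : Measure (Z i)))
      ≤ ENNReal.ofReal (C i))
    {δ : ℝ} (hδ : 0 < δ) :
    ∃ E : Set (∀ i, Fin (m i) → Z i), MeasurableSet E ∧ 1 - δ ≤ (dataLaw m D).real E ∧
      ∀ S ∈ E, ∀ (hyperPost : ProbabilityMeasure (ProbabilityMeasure F))
        (Q : Fin n → ProbabilityMeasure F),
        InformationTheory.klDiv (jointPosterior hyperPost Q) (jointPrior n hyperPrior) ≠ ⊤ →
        ∀ a b c : Fin n → ℝ,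
          (∀ i f, ENNReal.ofReal (Real.exp (∑ j, (a i * ℓ i f (S i j)
            + b i * ∫ z, ℓ i f z ∂(D i : Measure (Z i)) + c i))) ≤ G i f (S i)) →
          ∑ i, m i * (a i * empRisk (ℓ i) (S i) (Q i) + b i * risk (D i) (ℓ i) (Q i) + c i)
            ≤ (InformationTheory.klDiv (jointPosterior hyperPost Q) (jointPrior n hyperPrior)).toReal
              + (Real.log (1 / δ) + ∑ i, Real.log (C i)) := by
  obtain ⟨E, hEm, hEδ, hE⟩ := exists_event_integral_le m D hyperPrior G hG C hC hGC hδ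
  refine ⟨E, hEm, hEδ, fun S hS hyperPost Q hkl a b c habc => ?_⟩
  have key := hE S hS hyperPost Q hkl (fun i f => ∑ j, (a i * ℓ i f (S i j)
    + b i * ∫ z, ℓ i f z ∂(D i : Measure (Z i)) + c i)) (fun i => ?_) (fun i => ?_) habc
  · simpa only [integral_sum_affine_loss _ _ (hℓ _) (h1 _) (hm _)] using key
  · refine Finset.measurable_sum _ fun j _ => ?_
    exact ((((hℓ i).comp measurable_prodMk_right).const_mul (a i)).add
      (((hℓ i).stronglyMeasurable.integral_prod_right (ν := (D i : Measure (Z i)))).measurable.const_mul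
        (b i))).add_const (c i)
  · refine ⟨∑ _j : Fin (m i), (|a i| + |b i| + |c i|), fun f =>
      (Finset.abs_sum_le_sum_abs _ _).trans (Finset.sum_le_sum fun j _ => ?_)⟩
    have hx := h1 i f (S i j)
    have hp := integral_mem_Icc (D i : Measure (Z i)) (h1 i f)
    refine (abs_add_le _ _).trans (add_le_add ((abs_add_le _ _).trans (add_le_add ?_ ?_)) le_rfl)
    · rw [abs_mul, abs_of_nonneg hx.1]
      exact mul_le_of_le_one_right (abs_nonneg _) hx.2
    · rw [abs_mul, abs_of_nonneg hp.1]
      exact mul_le_of_le_one_right (abs_nonneg _) hp.2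

/-! ### Binary relative entropy as a supremum of affine functionals -/

section BinaryKL

/-- The maximiser `t = q / p` fails to be positive when `q = 0`; then `t = ε` loses only `p * ε ≤
ε`. -/
theorem exists_mul_log_div_sub_le {q p : ℝ} (hq : 0 ≤ q) (hp : p ∈ Set.Icc (0 : ℝ) 1)
    (hpq : p = 0 → q = 0) {ε : ℝ} (hε : 0 < ε) :
    ∃ t, 0 < t ∧ q * Real.log (q / p) - ε ≤ q * Real.log t - p * t + q := by
  rcases hq.eq_or_lt with rfl | hq0
  · exact ⟨ε, hε, by nlinarith [hp.2]⟩
  · have hp0 : 0 < p := hp.1.lt_of_ne fun h => hq0.ne' (hpq h.symm)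
    refine ⟨q / p, by positivity, ?_⟩
    rw [mul_div_cancel₀ q hp0.ne']
    linarith

theorem exists_lt_klTangent {q p : ℝ} (hq : q ∈ Set.Icc (0 : ℝ) 1) (hp : p ∈ Set.Icc (0 : ℝ) 1)
    {r : ℝ} (hr : (r : EReal) < binKL q p) :
    ∃ t u, 0 < t ∧ 0 < u ∧ r < klTangent t u q p := by
  by_cases htop : (p = 0 ∧ q ≠ 0) ∨ (p = 1 ∧ q ≠ 1)
  -- Where kl is infinite, one logarithmic term is unpenalised and can be tuned to give the value `r
  -- + 1`.
  · rcases htop with ⟨rfl, hq0⟩ | ⟨rfl, hq1⟩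
    · refine ⟨Real.exp ((r + 1) / q), 1, Real.exp_pos _, one_pos, ?_⟩
      simp [klTangent, mul_div_cancel₀ _ hq0]
    · refine ⟨1, Real.exp ((r + 1) / (1 - q)), one_pos, Real.exp_pos _, ?_⟩
      simp [klTangent, mul_div_cancel₀ _ (sub_ne_zero.mpr hq1.symm)]
  · rw [binKL, if_neg htop, EReal.coe_lt_coe_iff] at hr
    push Not at htop
    -- Each of the two halves loses at most `ε`, so a third of the gap keeps the inequality strict.
    set ε := (q * Real.log (q / p) + (1 - q) * Real.log ((1 - q) / (1 - p)) - r) / 3 with hε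
    have hε0 : 0 < ε := by rw [hε]; linarith
    obtain ⟨t, ht, h1⟩ := exists_mul_log_div_sub_le hq.1 hp htop.1 hε0
    obtain ⟨u, hu, h2⟩ := exists_mul_log_div_sub_le (q := 1 - q) (p := 1 - p)
      (sub_nonneg.mpr hq.2) ⟨sub_nonneg.mpr hp.2, by linarith [hp.1]⟩
      (fun h => by rw [htop.2 (by linarith)]; ring) hε0
    refine ⟨t, u, ht, hu, ?_⟩
    rw [klTangent]
    linarith

theorem binKL_ne_bot (q p : ℝ) : binKL q p ≠ ⊥ := by
  unfold binKL
  split_ifs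
  · exact top_ne_bot
  · exact EReal.coe_ne_bot _

/-- Upper bounds for all tangent functionals pass to the binary relative entropies. -/
theorem sum_mul_binKL_le {n : ℕ} {m : Fin n → ℕ} (hm : ∀ i, 1 ≤ m i) {q p : Fin n → ℝ}
    (hq : ∀ i, q i ∈ Set.Icc (0 : ℝ) 1) (hp : ∀ i, p i ∈ Set.Icc (0 : ℝ) 1) {B : ℝ}
    (h : ∀ t u : Fin n → ℝ, (∀ i, 0 < t i) → (∀ i, 0 < u i) →
      ∑ i, m i * klTangent (t i) (u i) (q i) (p i) ≤ B) :
    ∑ i, (m i : EReal) * binKL (q i) (p i) ≤ B := by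
  have hm0 : ∀ i, (0 : ℝ) < m i := fun i => by exact_mod_cast hm i
  have hreal : ∀ r : Fin n → ℝ, (∀ i, (r i : EReal) < binKL (q i) (p i)) →
      ∑ i, m i * r i ≤ B := by
    intro r hr
    choose t u ht hu htu using fun i => exists_lt_klTangent (hq i) (hp i) (hr i)
    refine le_trans (Finset.sum_le_sum fun i _ => ?_) (h t u ht hu)
    exact mul_le_mul_of_nonneg_left (htu i).le (hm0 i).le
  have hlow : ∀ i, ∃ r : ℝ, (r : EReal) < binKL (q i) (p i) := fun i =>
    EReal.lt_iff_exists_real_btwn.mp (bot_lt_iff_ne_bot.mpr (binKL_ne_bot (q i) (p i))) |>.imp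
      fun _ h => h.2
  choose r₀ hr₀ using hlow
  have htop : ∀ i, binKL (q i) (p i) ≠ ⊤ := by
    intro i hi
    classical
    -- Chosen so that the weighted sum equals `B + 1`, contradicting the bound `B`.
    set M := (B + 1 - ∑ k ∈ Finset.univ.erase i, m k * r₀ k) / m i with hM
    have := hreal (Function.update r₀ i M) fun k => by
      rcases eq_or_ne k i with rfl | hk
      · rw [Function.update_self, hi]; exact EReal.coe_lt_top _
      · rw [Function.update_of_ne hk]; exact hr₀ k
    rw [← Finset.add_sum_erase _ _ (Finset.mem_univ i), Function.update_self, hM,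
      mul_div_cancel₀ _ (hm0 i).ne'] at this
    have hrest : ∑ k ∈ Finset.univ.erase i, m k * Function.update r₀ i M k
        = ∑ k ∈ Finset.univ.erase i, m k * r₀ k := Finset.sum_congr rfl fun k hk => by
      rw [Function.update_of_ne (Finset.ne_of_mem_erase hk)]
    rw [← hM, hrest] at this
    linarith
  set v : Fin n → ℝ := fun i => (binKL (q i) (p i)).toReal with hv
  have hcoe : ∀ i, binKL (q i) (p i) = (v i : EReal) := fun i =>
    (EReal.coe_toReal (htop i) (binKL_ne_bot _ _)).symm
  have hsum : ∑ i, m i * v i ≤ B := by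
    refine le_of_forall_pos_le_add fun ε hε => ?_
    set N : ℝ := ∑ i, (m i : ℝ) with hN
    have hN0 : 0 ≤ N := Finset.sum_nonneg fun i _ => (hm0 i).le
    -- The `+ 1` keeps the denominator positive even without tasks.
    have hη : 0 < ε / (N + 1) := by positivity
    have := hreal (fun i => v i - ε / (N + 1)) fun i => by
      rw [hcoe i, EReal.coe_lt_coe_iff]; linarith
    simp only [mul_sub, Finset.sum_sub_distrib, ← Finset.sum_mul] at this
    have h2 : N * (ε / (N + 1)) ≤ ε := by
      rw [mul_div_assoc', div_le_iff₀ (by positivity)]; nlinarith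
    linarith
  calc ∑ i, (m i : EReal) * binKL (q i) (p i) = ((∑ i, m i * v i : ℝ) : EReal) := by
        refine Eq.trans ?_ (map_sum (⟨⟨Real.toEReal, EReal.coe_zero⟩, EReal.coe_add⟩ : ℝ →+ EReal)
          (fun i => m i * v i) Finset.univ).symm
        refine Finset.sum_congr rfl fun i _ => ?_
        rw [hcoe i, ← EReal.coe_natCast]
        exact (EReal.coe_mul _ _).symm
    _ ≤ B := EReal.coe_le_coe_iff.mpr hsum

end BinaryKL

/-! ### Exponential moment for fixed `λ` -/

section ExponentialMoment

theorem exp_neg_mul_le {x : ℝ} (hx : x ∈ Set.Icc (0 : ℝ) 1) (c : ℝ) :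
    Real.exp (-c * x) ≤ 1 - x + x * Real.exp (-c) := by
  have := convexOn_exp.2 (Set.mem_univ (-c)) (Set.mem_univ 0) hx.1 (sub_nonneg.mpr hx.2) (by ring)
  simp only [smul_eq_mul, mul_zero, add_zero, Real.exp_zero, mul_one] at this
  rw [mul_comm]
  linarith

theorem one_sub_add_mul_exp_pos {p : ℝ} (hp : p ∈ Set.Icc (0 : ℝ) 1) (c : ℝ) :
    0 < 1 - p + p * Real.exp (-c) := by
  have := convexComb_pos hp (Real.exp_pos (-c)) one_pos
  linarith

/-- The chord bound for `exp` has mean equal to the normalising denominator, so each independent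
factor has mean at most `1`. -/
theorem lintegral_prod_exp_div_le {Z : Type*} [MeasurableSpace Z] (D : Measure Z)
    [IsProbabilityMeasure D] (m : ℕ) (c : ℝ) {g : Z → ℝ} (hg : Measurable g)
    (hg1 : ∀ z, g z ∈ Set.Icc (0 : ℝ) 1) :
    ∫⁻ s, ∏ j, ENNReal.ofReal (Real.exp (-c * g (s j))
        / (1 - ∫ z, g z ∂D + (∫ z, g z ∂D) * Real.exp (-c))) ∂(Measure.pi fun _ : Fin m => D)
      ≤ 1 := by
  have hp := integral_mem_Icc D hg1
  have hw := one_sub_add_mul_exp_pos hp c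
  have hint : Integrable g D := Integrable.of_mem_Icc 0 1 hg.aemeasurable (ae_of_all _ hg1)
  have hsub : Integrable (fun z => 1 - g z) D := (integrable_const 1).sub hint
  have hle : ∫⁻ z, ENNReal.ofReal (Real.exp (-c * g z)
      / (1 - ∫ z, g z ∂D + (∫ z, g z ∂D) * Real.exp (-c))) ∂D ≤ 1 := by
    calc _ ≤ ∫⁻ z, ENNReal.ofReal ((1 - g z + g z * Real.exp (-c))
          / (1 - ∫ z, g z ∂D + (∫ z, g z ∂D) * Real.exp (-c))) ∂D := by
          refine lintegral_mono fun z => ENNReal.ofReal_le_ofReal ?_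
          exact div_le_div_of_nonneg_right (exp_neg_mul_le (hg1 z) c) hw.le
      _ = ENNReal.ofReal (∫ z, (1 - g z + g z * Real.exp (-c))
          / (1 - ∫ z, g z ∂D + (∫ z, g z ∂D) * Real.exp (-c)) ∂D) := by
          refine (ofReal_integral_eq_lintegral_ofReal
            ((hsub.add (hint.mul_const _)).div_const _) (ae_of_all _ fun z => ?_)).symm
          exact div_nonneg (one_sub_add_mul_exp_pos (hg1 z) c).le hw.le
      _ = 1 := by
          rw [integral_div, integral_add hsub (hint.mul_const _), integral_mul_const,
            integral_sub (integrable_const 1) hint]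
          simp [div_self hw.ne']
  rw [lintegral_pi_prod (fun _ : Fin m => D) fun _ =>
    (((hg.const_mul (-c)).exp).div_const _).ennreal_ofReal]
  exact Finset.prod_le_one' fun _ _ => hle

end ExponentialMoment

end PACBayesMTL

/-! ### The two PAC-Bayes bounds -/

theorem theorem3p2 {n : ℕ} {F : Type*} [MeasurableSpace F]
    {Z : Fin n → Type*} [∀ i, MeasurableSpace (Z i)]
    (m : Fin n → ℕ) (hm : ∀ i, 1 ≤ m i)
    (D : ∀ i, ProbabilityMeasure (Z i))
    (ℓ : ∀ i, F → Z i → ℝ)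
    (hℓ_meas : ∀ i, Measurable (Function.uncurry (ℓ i)))
    (hℓ_mem : ∀ i f z, ℓ i f z ∈ Set.Icc (0 : ℝ) 1)
    (hyperPrior : ProbabilityMeasure (ProbabilityMeasure F)) :
    (∀ δ : ℝ, 0 < δ →
      ∃ E : Set (∀ i, Fin (m i) → Z i), MeasurableSet E ∧ 1 - δ ≤ (dataLaw m D).real E ∧
        ∀ S ∈ E, ∀ (hyperPost : ProbabilityMeasure (ProbabilityMeasure F))
          (Q : Fin n → ProbabilityMeasure F),
          ∑ i, (m i : EReal) * binKL (empRisk (ℓ i) (S i) (Q i)) (risk (D i) (ℓ i) (Q i))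
            ≤ (InformationTheory.klDiv (jointPosterior hyperPost Q) (jointPrior n hyperPrior) : EReal)
              + ((Real.log (1 / δ) + ∑ i, Real.log (2 * Real.sqrt (m i)) : ℝ) : EReal)) ∧
    (∀ δ : ℝ, 0 < δ → ∀ lam : Fin n → ℝ, (∀ i, 0 < lam i) →
      ∃ E : Set (∀ i, Fin (m i) → Z i), MeasurableSet E ∧ 1 - δ ≤ (dataLaw m D).real E ∧
        ∀ S ∈ E, ∀ (hyperPost : ProbabilityMeasure (ProbabilityMeasure F))
          (Q : Fin n → ProbabilityMeasure F),
          ((-∑ i, (m i : ℝ) * Real.log (1 - risk (D i) (ℓ i) (Q i)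
              + risk (D i) (ℓ i) (Q i) * Real.exp (-lam i / ((n : ℝ) * (m i : ℝ)))) : ℝ) : EReal)
            ≤ (((1 / (n : ℝ)) * ∑ i, lam i * empRisk (ℓ i) (S i) (Q i) : ℝ) : EReal)
              + (InformationTheory.klDiv (jointPosterior hyperPost Q) (jointPrior n hyperPrior) : EReal)
              + (Real.log (1 / δ) : EReal)) := by
  have hm0 : ∀ i, (0 : ℝ) < m i := fun i => by exact_mod_cast hm i
  have hsample : ∀ i (j : Fin (m i)),
      Measurable fun x : F × (Fin (m i) → Z i) => ℓ i x.1 (x.2 j) := fun i j =>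
    (hℓ_meas i).comp (measurable_fst.prodMk ((measurable_pi_apply j).comp measurable_snd))
  have hrisk : ∀ i, Measurable fun x : F × (Fin (m i) → Z i) =>
      ∫ z, ℓ i x.1 z ∂(D i : Measure (Z i)) := fun i =>
    ((hℓ_meas i).stronglyMeasurable.integral_prod_right
      (ν := (D i : Measure (Z i)))).measurable.comp measurable_fst
  have hriskmem : ∀ i f, ∫ z, ℓ i f z ∂(D i : Measure (Z i)) ∈ Set.Icc (0 : ℝ) 1 := fun i f =>
    integral_mem_Icc _ (hℓ_mem i f)
  refine ⟨fun δ hδ => ?_, fun δ hδ lam _ => ?_⟩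
  · obtain ⟨E, hEm, hEδ, hE⟩ := exists_event_affine_le m hm D ℓ hℓ_meas hℓ_mem hyperPrior
      (fun i f s => klMixture (∫ z, ℓ i f z ∂(D i : Measure (Z i))) fun j => ℓ i f (s j))
      (fun i => measurable_klMixture (hrisk i) (hsample i))
      (fun i => 2 * √(m i)) (fun i => mul_pos two_pos (Real.sqrt_pos.mpr (hm0 i)))
      (fun i f => lintegral_klMixture_le _ (hm i) ((hℓ_meas i).comp measurable_prodMk_left)
        (hℓ_mem i f)) hδ
    refine ⟨E, hEm, hEδ, fun S hS hyperPost Q => ?_⟩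
    rcases eq_or_ne (InformationTheory.klDiv (jointPosterior hyperPost Q)
      (jointPrior n hyperPrior)) ⊤ with hkl | hkl
    · rw [hkl, EReal.coe_ennreal_top, EReal.top_add_coe]
      exact le_top
    rw [← EReal.coe_ennreal_toReal hkl, ← EReal.coe_add]
    refine sum_mul_binKL_le hm (fun i => empRisk_mem_Icc (hm i) _ _ (hℓ_mem i))
      (fun i => risk_mem_Icc _ _ (hℓ_mem i)) fun t u ht hu => ?_
    -- Exhibits the tangent functional in the form `a q + b p + c`, with coefficients depending on
    -- `t, u` alone.
    have haff : ∀ i q p, (Real.log (t i) - Real.log (u i)) * q + (u i - t i) * p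
        + (Real.log (u i) - u i + 1) = klTangent (t i) (u i) q p := fun i q p => by
      rw [klTangent]; ring
    have key := hE S hS hyperPost Q hkl (fun i => Real.log (t i) - Real.log (u i))
      (fun i => u i - t i) (fun i => Real.log (u i) - u i + 1)
    simp only [haff] at key
    exact key fun i f => ofReal_exp_sum_klTangent_le (hriskmem i f) (ht i) (hu i)
      fun j => hℓ_mem i f (S i j)
  · set c : Fin n → ℝ := fun i => lam i / (n * m i) with hc
    obtain ⟨E, hEm, hEδ, hE⟩ := exists_event_affine_le m hm D ℓ hℓ_meas hℓ_mem hyperPrior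
      (fun i f s => ∏ j, ENNReal.ofReal (Real.exp (-c i * ℓ i f (s j))
        / (1 - ∫ z, ℓ i f z ∂(D i : Measure (Z i))
          + (∫ z, ℓ i f z ∂(D i : Measure (Z i))) * Real.exp (-c i))))
      (fun i => Finset.measurable_prod _ fun j _ => ((((hsample i j).const_mul _).exp).div
        ((measurable_const.sub (hrisk i)).add ((hrisk i).mul_const _))).ennreal_ofReal)
      (fun _ => 1) (fun _ => one_pos)
      (fun i f => (lintegral_prod_exp_div_le _ _ _ ((hℓ_meas i).comp measurable_prodMk_left)
        (hℓ_mem i f)).trans_eq ENNReal.ofReal_one.symm) hδ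
    refine ⟨E, hEm, hEδ, fun S hS hyperPost Q => ?_⟩
    rcases eq_or_ne (InformationTheory.klDiv (jointPosterior hyperPost Q)
      (jointPrior n hyperPrior)) ⊤ with hkl | hkl
    · rw [hkl, EReal.coe_ennreal_top, EReal.coe_add_top, EReal.top_add_coe]
      exact le_top
    rw [← EReal.coe_ennreal_toReal hkl, ← EReal.coe_add, ← EReal.coe_add, EReal.coe_le_coe_iff]
    set p : Fin n → ℝ := fun i => risk (D i) (ℓ i) (Q i) with hp
    set w : Fin n → ℝ := fun i => 1 - p i + p i * Real.exp (-c i) with hw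
    have hw0 : ∀ i, 0 < w i := fun i =>
      one_sub_add_mul_exp_pos (risk_mem_Icc _ _ (hℓ_mem i)) (c i)
    -- The last two coefficients describe the tangent to `-log (1 - r + r exp (-c i))` at `r = p i`.
    -- They depend on the posterior, which is allowed because `E` is already fixed.
    have key := hE S hS hyperPost Q hkl (fun i => -c i) (fun i => (1 - Real.exp (-c i)) / w i)
      (fun i => -Real.log (w i) - (1 - w i) / w i) fun i f => ?_
    · have hterm : ∀ i, m i * (-c i * empRisk (ℓ i) (S i) (Q i) + (1 - Real.exp (-c i)) / w i * p i
          + (-Real.log (w i) - (1 - w i) / w i))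
          = -(1 / n * (lam i * empRisk (ℓ i) (S i) (Q i))) - m i * Real.log (w i) := by
        intro i
        -- At the point of tangency the linear correction vanishes.
        have hzero : (1 - Real.exp (-c i)) / w i * p i - (1 - w i) / w i = 0 := by
          rw [div_mul_eq_mul_div, ← sub_div, show (1 - Real.exp (-c i)) * p i - (1 - w i) = 0 by
            simp only [hw]; ring, zero_div]
        have hmc : (m i : ℝ) * c i = 1 / n * lam i := by
          have := (hm0 i).ne'
          simp only [hc]
          field_simp
        linear_combination (m i : ℝ) * hzero - empRisk (ℓ i) (S i) (Q i) * hmc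
      rw [Finset.sum_congr rfl fun i _ => hterm i, Finset.sum_sub_distrib, Finset.sum_neg_distrib,
        ← Finset.mul_sum] at key
      simp only [Real.log_one, Finset.sum_const_zero, add_zero] at key
      simp only [neg_div]
      change -∑ i, (m i : ℝ) * Real.log (w i) ≤ _
      linarith
    · rw [Real.exp_sum, ENNReal.ofReal_prod_of_nonneg fun j _ => (Real.exp_pos _).le]
      refine Finset.prod_le_prod' fun j _ => ENNReal.ofReal_le_ofReal ?_
      set r := ∫ z, ℓ i f z ∂(D i : Measure (Z i))
      have hv0 := one_sub_add_mul_exp_pos (hriskmem i f) (c i)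
      set v := 1 - r + r * Real.exp (-c i) with hv
      -- Away from it, concavity of `log` keeps the tangent below `-log v`, so the exponential stays
      -- below the moment statistic.
      have hlog : Real.log v - Real.log (w i) ≤ v / w i - 1 := by
        rw [← Real.log_div hv0.ne' (hw0 i).ne']
        exact Real.log_le_sub_one_of_pos (div_pos hv0 (hw0 i))
      have hsum : (1 - Real.exp (-c i)) / w i * r - (1 - w i) / w i = 1 - v / w i := by
        have := (hw0 i).ne'
        field_simp
        rw [hv]
        ring
      calc _ ≤ Real.exp (-c i * ℓ i f (S i j) - Real.log v) := by
            refine Real.exp_le_exp.mpr ?_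
            linarith
        _ = _ := by rw [Real.exp_sub, Real.exp_log hv0]
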